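/- Let $\mathsf{Pos}$ be the category of posets and monotone maps, and fix a representative set $\mathsf{Pos}_f$ of finite posets up to isomorphism, whose members are called contexts. A signature is a family $\Sigma=(\Sigma_\Gamma)_{\Gamma\in\mathsf{Pos}_f}$ of sets. A $\Sigma$-algebra is a poset $A$ with a map $\sigma_A\colon \mathsf{Pos}(\Gamma,A)\to A$ (not necessarily monotone) for each context $\Gamma$ and each $\sigma\in\Sigma_\Gamma$; it is coherent if every $\sigma_A$ is monotone for the pointwise order on $\mathsf{Pos}(\Gamma,A)$. Homomorphisms are the monotone maps that commute with the operations. The terms in context $\Gamma$ form the least set that contains the elements of $\Gamma$ (the variables) and contains $\sigma(g)$ for all contexts $\Delta$, all $\sigma\in\Sigma_\Delta$ and all maps $g$ from the underlying set of $\Delta$ to the set of terms. Given a monotone map $f\colon\Gamma\to A$, the partial evaluation map $f^\#$ from terms to $A$ is defined by $f^\#(x)=f(x)$ for variables $x$ and $f^\#(\sigma(g))=\sigma_A(f^\#\cdot g)$, where the latter is defined iff all $f^\#(g(i))$ are defined and $i\le j$ in $\Delta$ implies $f^\#(g(i))\le f^\#(g(j))$. The algebra $A$ satisfies an inequation $\Gamma\vdash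 s\le t$ between terms in context $\Gamma$ if for every monotone $f\colon\Gamma\to A$ both $f^\#(s)$ and $f^\#(t)$ are defined and $f^\#(s)\le f^\#(t)$; an equation $\Gamma\vdash s=t$ stands for the two inequations $\Gamma\vdash s\le t$ and $\Gamma\vdash t\le s$. A variety of coherent algebras is the full subcategory of all coherent $\Sigma$-algebras that satisfy a given set of inequations in context, for some signature $\Sigma$. A monad $\mathbb T=(T,\eta,\mu)$ on $\mathsf{Pos}$ is finitary if $T$ preserves filtered colimits, and enriched if $f_1\le f_2$ (pointwise) implies $Tf_1\le Tf_2$ for all monotone maps $f_1,f_2\colon X\to Y$. The variety $\mathcal V_{\mathbb T}$ associated with a finitary monad $\mathbb T$ has as operation symbols of arity $\Gamma$ the elements of $T\Gamma$, and consists of all algebras for this signature that satisfy the following, where a symbol $\sigma\in T\Gamma$ also denotes the term $\sigma(x)_{x\in\Gamma}$ in context $\Gamma$: 1. $\Gamma\vdash\sigma\le\tau$ for all $\sigma\le\tau$ in $T\Gamma$; 2. $\Gamma\vdash k^*(\sigma)=\sigma(k)$ for all contexts $\Delta$, all monotone $k\colon\Delta\to T\Gamma$ and all $\sigma\in T\Delta$,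 where $k^*=\mu_\Gamma\cdot Tk$; 3. $\Gamma\vdash\eta_\Gamma(x)=x$ for all $x\in\Gamma$. Proposition. (a) If $\mathbb T$ is an enriched finitary monad on $\mathsf{Pos}$, then all algebras of the associated variety $\mathcal V_{\mathbb T}$ are coherent. (b) Conversely, for every variety $\mathcal V$ of coherent algebras, the forgetful functor $\mathcal V\to\mathsf{Pos}$ has a left adjoint, and the induced free-algebra monad $\mathbb T_{\mathcal V}$ is enriched, i.e. $f_1\le f_2$ in $\mathsf{Pos}(X,Y)$ implies $T_{\mathcal V}f_1\le T_{\mathcal V}f_2$. -/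

import Mathlib

open CategoryTheory

universe u

namespace OrderedAlgebra

/-- A representative set of finite posets up to isomorphism: a set of finite posets, called
contexts, such that every finite poset is isomorphic to exactly one of them. -/
structure Contexts where
  /-- The (small) set of contexts. -/
  Idx : Type u
  /-- The poset that is the context. -/
  poset : Idx → PartOrd.{u}
  finite : ∀ Γ, Finite (poset Γ)
  exists_iso : ∀ (P : Type u) [PartialOrder P] [Finite P], ∃ Γ, Nonempty (P ≃o poset Γ)
  eq_of_iso : ∀ Γ Δ, Nonempty (poset Γ ≃o poset Δ) → Γ = Δ

variable {R : Contexts.{u}}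

/-- A signature in context: a set of operation symbols for each context (their arity). -/
abbrev Signature (R : Contexts.{u}) : Type (u + 1) := R.Idx → Type u

/-- An ordered algebra: a poset `A` with a map `σ_A` from the set of monotone maps `Γ → A` to `A`
for each operation symbol `σ` of arity `Γ`. The operations need not be monotone. -/
structure Alg (S : Signature R) where
  /-- The underlying poset. -/
  carrier : PartOrd.{u}
  /-- The operations. -/
  op : ∀ {Γ : R.Idx}, S Γ → (R.poset Γ →o carrier) → carrier

namespace Alg

variable {S : Signature R}

/-- An algebra is coherent if its operations are monotone, for the pointwise order on the
monotone maps `Γ → A`. -/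
def Coherent (A : Alg S) : Prop :=
  ∀ (Γ : R.Idx) (σ : S Γ), Monotone (A.op σ)

/-- Homomorphisms: monotone maps that commute with the operations. -/
@[ext]
structure Hom (A B : Alg S) where
  /-- The underlying monotone map. -/
  toOrderHom : A.carrier →o B.carrier
  map_op : ∀ (Γ : R.Idx) (σ : S Γ) (f : R.poset Γ →o A.carrier),
    toOrderHom (A.op σ f) = B.op σ (toOrderHom.comp f)

instance : Category (Alg S) where
  Hom := Hom
  id A := ⟨OrderHom.id, fun _ _ _ => rfl⟩
  comp h k := ⟨k.toOrderHom.comp h.toOrderHom, fun Γ σ f => by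
    simp only [OrderHom.comp_coe, Function.comp_apply, h.map_op, k.map_op]
    rfl⟩

/-- The forgetful functor from ordered algebras to posets. -/
def forget (S : Signature R) : Alg S ⥤ PartOrd.{u} where
  obj A := A.carrier
  map h := PartOrd.ofHom h.toOrderHom

end Alg

/-- Terms over a set `V` of variables; the order of the arities is ignored. -/
inductive Term (S : Signature R) (V : Type u) : Type u
  | var : V → Term S V
  | app {Δ : R.Idx} (σ : S Δ) (g : R.poset Δ → Term S V) : Term S V

/-- An operation symbol `σ` of arity `Γ` regarded as the term `σ(x₁, …, xₙ)` in the
variables of `Γ`. -/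
def Term.ofSymbol {S : Signature R} {Γ : R.Idx} (σ : S Γ) : Term S (R.poset Γ) :=
  .app σ .var

/-- Evaluation of terms in context `Γ` under a monotone interpretation `f : Γ → A`, a partial map:
the value of `σ(g)` is defined iff the values of all terms `g i` are defined and depend
monotonically on `i`. -/
def Alg.eval {S : Signature R} (A : Alg S) {Γ : R.Idx} (f : R.poset Γ →o A.carrier) :
    Term S (R.poset Γ) → Part A.carrier
  | .var x => Part.some (f x)
  | .app σ g =>
    { Dom := ∃ h : ∀ i, (A.eval f (g i)).Dom,
        ∀ i j, i ≤ j → (A.eval f (g i)).get (h i) ≤ (A.eval f (g j)).get (h j)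
      get := fun H => A.op σ ⟨fun i => (A.eval f (g i)).get (H.1 i), fun i j hij => H.2 i j hij⟩ }

/-- An inequation `Γ ⊢ lhs ≤ rhs` in context. -/
structure Inequation (S : Signature R) where
  /-- The context. -/
  ctx : R.Idx
  /-- The smaller term. -/
  lhs : Term S (R.poset ctx)
  /-- The larger term. -/
  rhs : Term S (R.poset ctx)

/-- `A` satisfies `Γ ⊢ s ≤ t` if for every monotone `f : Γ → A` the values of `s` and `t` under `f`
are both defined and the former is below the latter. -/
def Alg.Satisfies {S : Signature R} (A : Alg S) (e : Inequation S) : Prop :=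
  ∀ f : R.poset e.ctx →o A.carrier, ∃ (hl : (A.eval f e.lhs).Dom) (hr : (A.eval f e.rhs).Dom),
    (A.eval f e.lhs).get hl ≤ (A.eval f e.rhs).get hr

/-- The objects of the variety of ordered algebras specified by a set `E` of inequations. -/
def variety {S : Signature R} (E : Set (Inequation S)) : ObjectProperty (Alg S) :=
  fun A => ∀ e ∈ E, A.Satisfies e

/-- The objects of the variety of coherent algebras specified by a set `E` of inequations. -/
def coherentVariety {S : Signature R} (E : Set (Inequation S)) : ObjectProperty (Alg S) :=
  fun A => A.Coherent ∧ variety E A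

/-- The forgetful functor to posets of the variety of coherent algebras specified by `E`, a full
subcategory of the category of all ordered algebras. -/
def coherentForget {S : Signature R} (E : Set (Inequation S)) :
    (coherentVariety E).FullSubcategory ⥤ PartOrd.{u} :=
  (coherentVariety E).ι ⋙ Alg.forget S

/-- A monad on posets is enriched if its endofunctor is locally monotone: `f ≤ g` pointwise
implies `T f ≤ T g` pointwise. -/
def Enriched (T : Monad PartOrd.{u}) : Prop :=
  ∀ ⦃X Y : PartOrd.{u}⦄ (f g : X ⟶ Y), f.hom ≤ g.hom → (T.map f).hom ≤ (T.map g).hom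

/-- The signature associated with a monad `T`: the operation symbols of arity `Γ` are the elements
of `T Γ`. -/
def assocSignature (R : Contexts.{u}) (T : Monad PartOrd.{u}) : Signature R :=
  fun Γ => T.obj (R.poset Γ)

/-- An element of `T Γ` as an operation symbol of arity `Γ`. -/
def symb {T : Monad PartOrd.{u}} {Γ : R.Idx} (σ : T.obj (R.poset Γ)) : assocSignature R T Γ := σ

/-- The Kleisli extension `k* = μ_Y ∘ T k : T X → T Y` of `k : X → T Y`. -/
def kleisliExt (T : Monad PartOrd.{u}) {X Y : PartOrd.{u}} (k : X ⟶ T.obj Y) :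
    T.obj X ⟶ T.obj Y :=
  T.map k ≫ T.μ.app Y

/-- The inequations that define the variety associated with a monad `T`. -/
inductive AssocInequation (R : Contexts.{u}) (T : Monad PartOrd.{u}) :
    Inequation (assocSignature R T) → Prop
  /-- `Γ ⊢ σ ≤ τ` for `σ ≤ τ` in `T Γ`. -/
  | le (Γ : R.Idx) (σ τ : T.obj (R.poset Γ)) (h : σ ≤ τ) :
      AssocInequation R T ⟨Γ, .ofSymbol (symb σ), .ofSymbol (symb τ)⟩
  /-- `Γ ⊢ k*(σ) ≤ σ(k)` for monotone `k : Δ → T Γ` and `σ ∈ T Δ`. -/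
  | ext_le (Γ Δ : R.Idx) (k : R.poset Δ ⟶ T.obj (R.poset Γ)) (σ : T.obj (R.poset Δ)) :
      AssocInequation R T ⟨Γ, .ofSymbol (symb (kleisliExt T k σ)),
        .app (symb σ) (fun i => .ofSymbol (symb (k i)))⟩
  /-- `Γ ⊢ σ(k) ≤ k*(σ)` for monotone `k : Δ → T Γ` and `σ ∈ T Δ`. -/
  | le_ext (Γ Δ : R.Idx) (k : R.poset Δ ⟶ T.obj (R.poset Γ)) (σ : T.obj (R.poset Δ)) :
      AssocInequation R T ⟨Γ, .app (symb σ) (fun i => .ofSymbol (symb (k i))),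
        .ofSymbol (symb (kleisliExt T k σ))⟩
  /-- `Γ ⊢ η(x) ≤ x` for `x ∈ Γ`. -/
  | unit_le (Γ : R.Idx) (x : R.poset Γ) :
      AssocInequation R T ⟨Γ, .ofSymbol (symb (T.η.app (R.poset Γ) x)), .var x⟩
  /-- `Γ ⊢ x ≤ η(x)` for `x ∈ Γ`. -/
  | le_unit (Γ : R.Idx) (x : R.poset Γ) :
      AssocInequation R T ⟨Γ, .var x, .ofSymbol (symb (T.η.app (R.poset Γ) x))⟩

/-- The set of inequations that define the variety associated with a monad `T`. -/
def assocInequations (R : Contexts.{u}) (T : Monad PartOrd.{u}) :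
    Set (Inequation (assocSignature R T)) :=
  {e | AssocInequation R T e}

end OrderedAlgebra

/-! For (a), let `v ≤ w` be monotone maps from `Γ` to `A`. Together they are one monotone map on `Γ
× 2`, a finite poset and hence a context `Δ` up to isomorphism. The two inclusions of `Γ` into `Δ`
are comparable, so an enriched `T` sends `σ` to comparable elements of `T Δ`, whose operations on
`A` are then comparable. By `op_symb_map` their values at the joint map are `σ` at `v` and `σ` at
`w`.

For (b), the free algebra on `X` consists of the terms that have a value in every algebra of the
variety under every monotone interpretation, preordered by these values and made antisymmetric. It
satisfies the inequations because each of their substitution instances holds throughout the variety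
(`freeAlg_evaluates`).

For enrichment, if `f ≤ g`, then the elements on which `F f` is below `F g` form a subalgebra of `F
X`, since operations on `F Y` are monotone. With the induced order it lies in the variety, and it
contains the generators; by the universal property it is all of `F X`. -/

namespace OrderedAlgebra

variable {R : Contexts.{u}} {S : Signature R}

/-! ### Values of terms as a relation, substitution, and subalgebras -/

/-- Simultaneous substitution of terms for variables. -/
def Term.bind {V W : Type u} (s : V → Term S W) : Term S V → Term S W
  | .var x => s x
  | .app σ g => .app σ fun i => (g i).bind s

theorem Term.bind_var {V : Type u} (t : Term S V) : t.bind .var = t := by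
  induction t with
  | var x => rfl
  | app σ g ih => simp only [Term.bind, ih]

namespace Alg

/-- The graph of the partial evaluation of terms over an arbitrary set of variables. -/
inductive Evaluates (A : Alg S) {V : Type u} (f : V → A.carrier) : Term S V → A.carrier → Prop
  | var (x : V) : Evaluates A f (.var x) (f x)
  | app {Δ : R.Idx} (σ : S Δ) (g : R.poset Δ → Term S V) (v : R.poset Δ →o A.carrier)
      (h : ∀ i, Evaluates A f (g i) (v i)) : Evaluates A f (.app σ g) (A.op σ v)

namespace Evaluates

variable {A : Alg S} {V : Type u} {f : V → A.carrier}

theorem var_iff {x : V} {a : A.carrier} : A.Evaluates f (.var x) a ↔ a = f x :=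
  ⟨fun h => by cases h; rfl, fun h => h ▸ .var x⟩

theorem app_iff {Δ : R.Idx} {σ : S Δ} {g : R.poset Δ → Term S V} {a : A.carrier} :
    A.Evaluates f (.app σ g) a ↔
      ∃ v : R.poset Δ →o A.carrier, (∀ i, A.Evaluates f (g i) (v i)) ∧ a = A.op σ v := by
  constructor
  · intro h
    cases h with
    | app _ _ v h => exact ⟨v, h, rfl⟩
  · rintro ⟨v, h, rfl⟩
    exact .app σ g v h

theorem unique {t : Term S V} {a b : A.carrier} (ha : A.Evaluates f t a)
    (hb : A.Evaluates f t b) : a = b := by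
  induction ha generalizing b with
  | var x => exact (var_iff.1 hb).symm
  | app σ g v _ ih =>
    obtain ⟨w, hw, rfl⟩ := app_iff.1 hb
    exact congrArg (A.op σ) (OrderHom.ext _ _ (funext fun i => ih i (hw i)))

/-- The substitution lemma. As an equivalence it transfers definedness along with values. -/
theorem bind_iff {W : Type u} {s : W → Term S V} {w : W → A.carrier}
    (hs : ∀ x, A.Evaluates f (s x) (w x)) {t : Term S W} {a : A.carrier} :
    A.Evaluates f (t.bind s) a ↔ A.Evaluates w t a := by
  induction t generalizing a with
  | var x => exact ⟨fun h => var_iff.2 (h.unique (hs x)), fun h => var_iff.1 h ▸ hs x⟩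
  | app σ g ih => simp only [Term.bind, app_iff, ih]

/-- Homomorphisms preserve values of terms. -/
theorem map {B : Alg S} (h : Hom A B) {t : Term S V} {a : A.carrier} (ha : A.Evaluates f t a) :
    B.Evaluates (fun x => h.toOrderHom (f x)) t (h.toOrderHom a) := by
  induction ha with
  | var x => exact .var x
  | app σ g v _ ih => exact h.map_op _ σ v ▸ .app σ g (h.toOrderHom.comp v) ih

/-- Homomorphisms that reflect the order reflect the definedness of terms. -/
theorem exists_of_map {B : Alg S} (h : Hom A B)
    (hr : ∀ x y, h.toOrderHom x ≤ h.toOrderHom y → x ≤ y) {t : Term S V} {b : B.carrier}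
    (hb : B.Evaluates (fun x => h.toOrderHom (f x)) t b) :
    ∃ a, h.toOrderHom a = b ∧ A.Evaluates f t a := by
  induction hb with
  | var x => exact ⟨f x, rfl, .var x⟩
  | app σ g v _ ih =>
    choose w hw hwe using ih
    refine ⟨A.op σ ⟨w, fun i j hij => hr _ _ ?_⟩, ?_, .app σ g _ hwe⟩
    · rw [hw, hw]
      exact v.monotone hij
    · rw [h.map_op]
      exact congrArg (B.op σ) (OrderHom.ext _ _ (funext hw))

end Evaluates

theorem mem_eval_iff (A : Alg S) {Γ : R.Idx} (f : R.poset Γ →o A.carrier)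
    {t : Term S (R.poset Γ)} {a : A.carrier} : a ∈ A.eval f t ↔ A.Evaluates f t a := by
  induction t generalizing a with
  | var x => simp [eval, Evaluates.var_iff]
  | app σ g ih =>
    rw [Evaluates.app_iff, eval]
    constructor
    · rintro ⟨H, rfl⟩
      exact ⟨_, fun i => (ih i).1 (Part.get_mem (H.1 i)), rfl⟩
    · rintro ⟨v, hv, rfl⟩
      have hd : ∀ i, ∃ h, (A.eval f (g i)).get h = v i := fun i => (ih i).2 (hv i)
      refine ⟨⟨fun i => (hd i).1, fun i j hij => ?_⟩, ?_⟩
      · rw [(hd i).2, (hd j).2]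
        exact v.monotone hij
      · exact congrArg (A.op σ) (OrderHom.ext _ _ (funext fun i => (hd i).2))

theorem satisfies_iff (A : Alg S) (e : Inequation S) :
    A.Satisfies e ↔ ∀ f : R.poset e.ctx →o A.carrier,
      ∃ a b, A.Evaluates f e.lhs a ∧ A.Evaluates f e.rhs b ∧ a ≤ b := by
  refine forall_congr' fun f => ?_
  simp only [← mem_eval_iff]
  constructor
  · rintro ⟨hl, hr, h⟩
    exact ⟨_, _, Part.get_mem hl, Part.get_mem hr, h⟩
  · rintro ⟨a, b, ⟨hl, rfl⟩, ⟨hr, rfl⟩, h⟩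
    exact ⟨hl, hr, h⟩

/-- Varieties of coherent algebras are closed under subalgebras with the induced order. -/
theorem coherentVariety_of_embedding {E : Set (Inequation S)} {A B : Alg S} (h : Hom A B)
    (hr : ∀ x y, h.toOrderHom x ≤ h.toOrderHom y → x ≤ y) (hB : coherentVariety E B) :
    coherentVariety E A := by
  refine ⟨fun Γ σ v w hvw => hr _ _ ?_, fun e he => (A.satisfies_iff e).2 fun f => ?_⟩
  · rw [h.map_op, h.map_op]
    exact hB.1 Γ σ fun i => h.toOrderHom.monotone (hvw i)
  · obtain ⟨a, b, ha, hb, hab⟩ := (B.satisfies_iff e).1 (hB.2 e he) (h.toOrderHom.comp f)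
    obtain ⟨a', rfl, ha'⟩ := Evaluates.exists_of_map (f := f) h hr ha
    obtain ⟨b', rfl, hb'⟩ := Evaluates.exists_of_map (f := f) h hr hb
    exact ⟨a', b', ha', hb', hr _ _ hab⟩

end Alg

/-! ### Free algebras -/

section FreeAlgebra

variable (E : Set (Inequation S)) (X : PartOrd.{u})

/-- The terms over `X` that have a value in every algebra of the variety under every monotone
interpretation of the variables. -/
def DefinedTerm : Type u :=
  {t : Term S X // ∀ (B : (coherentVariety E).FullSubcategory) (f : X →o B.obj.carrier),
    ∃ a, B.obj.Evaluates f t a}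

variable {E X}

namespace DefinedTerm

/-- The value of a term that is defined throughout the variety. -/
noncomputable def value (t : DefinedTerm E X) (B : (coherentVariety E).FullSubcategory)
    (f : X →o B.obj.carrier) : B.obj.carrier :=
  (t.2 B f).choose

theorem evaluates_value (t : DefinedTerm E X) (B : (coherentVariety E).FullSubcategory)
    (f : X →o B.obj.carrier) : B.obj.Evaluates f t.1 (t.value B f) :=
  (t.2 B f).choose_spec

theorem value_eq {t : DefinedTerm E X} {B : (coherentVariety E).FullSubcategory}
    {f : X →o B.obj.carrier} {a : B.obj.carrier} (h : B.obj.Evaluates f t.1 a) :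
    t.value B f = a :=
  (t.evaluates_value B f).unique h

/-- Terms are compared by their values in all algebras of the variety. -/
noncomputable instance : Preorder (DefinedTerm E X) where
  le s t := ∀ (B : (coherentVariety E).FullSubcategory) (f : X →o B.obj.carrier),
    s.value B f ≤ t.value B f
  le_refl _ _ _ := le_rfl
  le_trans _ _ _ h k B f := (h B f).trans (k B f)

/-- A variable as a term that is defined throughout the variety. -/
def var (x : X) : DefinedTerm E X :=
  ⟨.var x, fun _ f => ⟨f x, .var x⟩⟩

theorem value_var (x : X) (B : (coherentVariety E).FullSubcategory) (f : X →o B.obj.carrier) :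
    (var x : DefinedTerm E X).value B f = f x :=
  value_eq (.var x)

/-- An operation symbol applied to a monotone family of terms that are defined throughout the
variety. -/
noncomputable def app {Δ : R.Idx} (σ : S Δ) (g : R.poset Δ →o DefinedTerm E X) :
    DefinedTerm E X :=
  ⟨.app σ fun i => (g i).1, fun B f => ⟨_, .app σ _ ⟨fun i => (g i).value B f,
    fun _ _ hij => g.monotone hij B f⟩ fun i => (g i).evaluates_value B f⟩⟩

theorem value_app {Δ : R.Idx} (σ : S Δ) (g : R.poset Δ →o DefinedTerm E X)
    (B : (coherentVariety E).FullSubcategory) (f : X →o B.obj.carrier) :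
    (app σ g).value B f =
      B.obj.op σ ⟨fun i => (g i).value B f, fun _ _ hij => g.monotone hij B f⟩ :=
  value_eq (.app σ _ ⟨fun i => (g i).value B f,
    fun _ _ hij => g.monotone hij B f⟩ fun i => (g i).evaluates_value B f)

/-- A value of `σ(g)` in every algebra requires values of all `g i` that increase with `i`; this is
exactly monotonicity of `g` for the preorder on defined terms. -/
theorem exists_eq_app {Δ : R.Idx} {σ : S Δ} {g : R.poset Δ → Term S X} (t : DefinedTerm E X)
    (ht : t.1 = .app σ g) :
    ∃ g' : R.poset Δ →o DefinedTerm E X, (∀ i, (g' i).1 = g i) ∧ t = app σ g' := by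
  have key : ∀ (B : (coherentVariety E).FullSubcategory) (f : X →o B.obj.carrier),
      ∃ v : R.poset Δ →o B.obj.carrier, ∀ i, B.obj.Evaluates f (g i) (v i) := fun B f => by
    have h := t.evaluates_value B f
    rw [ht] at h
    obtain ⟨v, hv, -⟩ := Alg.Evaluates.app_iff.1 h
    exact ⟨v, hv⟩
  let g' (i : R.poset Δ) : DefinedTerm E X :=
    ⟨g i, fun B f => (key B f).elim fun v hv => ⟨v i, hv i⟩⟩
  refine ⟨⟨g', fun i j hij B f => ?_⟩, fun _ => rfl, Subtype.ext ht⟩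
  obtain ⟨v, hv⟩ := key B f
  rw [value_eq (t := g' i) (hv i), value_eq (t := g' j) (hv j)]
  exact v.monotone hij

end DefinedTerm

open DefinedTerm

variable (E X) in
/-- The underlying poset of the free algebra. -/
abbrev FreePoset : Type u := Antisymmetrization (DefinedTerm E X) (· ≤ ·)

namespace FreePoset

/-- The class of a term. -/
noncomputable def mk : DefinedTerm E X →o FreePoset E X :=
  ⟨toAntisymmetrization _, fun _ _ h => h⟩

/-- A representing term. -/
noncomputable def rep : FreePoset E X →o DefinedTerm E X :=
  ⟨ofAntisymmetrization _, fun _ _ h => ofAntisymmetrization_le_ofAntisymmetrization_iff.2 h⟩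

@[simp]
theorem mk_rep (q : FreePoset E X) : mk (rep q) = q :=
  toAntisymmetrization_ofAntisymmetrization _ q

theorem mk_eq_mk {s t : DefinedTerm E X} (h : ∀ B f, s.value B f = t.value B f) :
    mk s = mk t :=
  le_antisymm (mk.monotone fun B f => (h B f).le) (mk.monotone fun B f => (h B f).ge)

@[simp]
theorem value_rep_mk (t : DefinedTerm E X) (B : (coherentVariety E).FullSubcategory)
    (f : X →o B.obj.carrier) : (rep (mk t)).value B f = t.value B f := by
  have h : rep (mk t) ≤ t ∧ t ≤ rep (mk t) := Quotient.mk_out (s := AntisymmRel.setoid _ _) t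
  exact le_antisymm (h.1 B f) (h.2 B f)

end FreePoset

open FreePoset

variable (E X) in
/-- The free algebra on `X`. -/
noncomputable def freeAlg : Alg S where
  carrier := PartOrd.of (FreePoset E X)
  op σ g := mk (app σ (rep.comp g))

/-- The operations do not depend on the chosen representatives, because equivalent terms have equal
values everywhere. -/
theorem freeAlg_op_mk {Δ : R.Idx} (σ : S Δ) (g : R.poset Δ →o DefinedTerm E X) :
    (freeAlg E X).op σ (mk.comp g) = mk (app σ g) := by
  refine mk_eq_mk fun B f => ?_
  rw [value_app, value_app]
  exact congrArg (B.obj.op σ) (OrderHom.ext _ _ (funext fun i => value_rep_mk (g i) B f))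

/-- Evaluation in the free algebra is substitution of representatives. Definedness of the
substituted term throughout the variety, carried by `d`, passes to subterms by `exists_eq_app` and
makes the evaluation in the free algebra defined. -/
theorem freeAlg_evaluates {V : Type u} {f : V → FreePoset E X} (s : V → DefinedTerm E X)
    (hs : ∀ x, mk (s x) = f x) {t : Term S V} (d : DefinedTerm E X)
    (hd : d.1 = t.bind fun x => (s x).1) : (freeAlg E X).Evaluates f t (mk d) := by
  induction t generalizing d with
  | var x =>
    obtain rfl : d = s x := Subtype.ext hd
    exact Alg.Evaluates.var_iff.2 (hs x)
  | app σ g ih =>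
    obtain ⟨d, h, rfl⟩ := d.exists_eq_app hd
    rw [← freeAlg_op_mk]
    exact .app σ g _ fun i => ih i (d i) (h i)

/-- The monotone extension of a monotone map `X → B` to the free algebra. -/
noncomputable def freeExt (B : (coherentVariety E).FullSubcategory) (f : X →o B.obj.carrier) :
    FreePoset E X →o B.obj.carrier :=
  ⟨fun q => (rep q).value B f, fun _ _ h => rep.monotone h B f⟩

variable (E X) in
theorem coherentVariety_freeAlg : coherentVariety E (freeAlg E X) := by
  refine ⟨fun Γ σ v w hvw => mk.monotone fun B f => ?_, fun e he => ?_⟩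
  · rw [value_app, value_app]
    exact B.property.1 Γ σ fun i => rep.monotone (hvw i) B f
  · rw [Alg.satisfies_iff]
    intro f
    -- The substitution instance of `e` at the representatives of `f` holds in `B`: it amounts to
    -- `e` itself under the interpretation `freeExt B h ∘ f`, which is monotone.
    have key (B : (coherentVariety E).FullSubcategory) (h : X →o B.obj.carrier) :
        ∃ a b, B.obj.Evaluates h (e.lhs.bind fun x => (rep (f x)).1) a ∧
          B.obj.Evaluates h (e.rhs.bind fun x => (rep (f x)).1) b ∧ a ≤ b := by
      have hs : ∀ x, B.obj.Evaluates h (rep (f x)).1 ((freeExt B h).comp f x) :=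
        fun x => (rep (f x)).evaluates_value B h
      simp only [Alg.Evaluates.bind_iff hs]
      exact (B.obj.satisfies_iff e).1 (B.property.2 e he) _
    let l : DefinedTerm E X := ⟨_, fun B h => (key B h).imp fun _ ⟨_, ha, _⟩ => ha⟩
    let r : DefinedTerm E X := ⟨_, fun B h => (key B h).elim fun _ ⟨b, _, hb, _⟩ => ⟨b, hb⟩⟩
    refine ⟨mk l, mk r, freeAlg_evaluates _ (fun x => mk_rep (f x)) l rfl,
      freeAlg_evaluates _ (fun x => mk_rep (f x)) r rfl, mk.monotone fun B h => ?_⟩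
    obtain ⟨a, b, ha, hb, hab⟩ := key B h
    rwa [value_eq (t := l) ha, value_eq (t := r) hb]

variable (E X) in
/-- The free algebra on `X` as an object of the variety. -/
noncomputable def free : (coherentVariety E).FullSubcategory :=
  ⟨freeAlg E X, coherentVariety_freeAlg E X⟩

/-- The inclusion of variables into the free algebra. -/
noncomputable def freeVar : X →o FreePoset E X :=
  mk.comp ⟨DefinedTerm.var, fun x y h B f => by
    rw [value_var, value_var]
    exact f.monotone h⟩

theorem freeExt_freeVar (B : (coherentVariety E).FullSubcategory) (f : X →o B.obj.carrier)
    (x : X) : freeExt B f (freeVar x) = f x :=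
  (value_rep_mk _ B f).trans (value_var x B f)

/-- The extension of a monotone map `X → B` to a homomorphism on the free algebra. -/
noncomputable def freeLift (B : (coherentVariety E).FullSubcategory) (f : X →o B.obj.carrier) :
    Alg.Hom (freeAlg E X) B.obj where
  toOrderHom := freeExt B f
  map_op _ σ g := (value_rep_mk _ B f).trans (value_app σ (rep.comp g) B f)

/-- Uniqueness in the universal property: under `freeVar` a term evaluates to its own class, and
homomorphisms preserve values. -/
theorem free_hom_apply_mk {B : (coherentVariety E).FullSubcategory}
    (h : Alg.Hom (freeAlg E X) B.obj) (t : DefinedTerm E X) :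
    h.toOrderHom (mk t) = t.value B (h.toOrderHom.comp freeVar) :=
  (value_eq (Alg.Evaluates.map (f := freeVar) h
    (freeAlg_evaluates DefinedTerm.var (fun _ => rfl) t (Term.bind_var t.1).symm))).symm

variable (E X) in
/-- The universal property of the free algebra. -/
noncomputable def freeHomEquiv (B : (coherentVariety E).FullSubcategory) :
    (free E X ⟶ B) ≃ (X ⟶ (coherentForget E).obj B) where
  toFun h := PartOrd.ofHom (h.hom.toOrderHom.comp freeVar)
  invFun f := ObjectProperty.homMk (freeLift B f.hom)
  left_inv h := by
    refine ObjectProperty.hom_ext _ (Alg.Hom.ext (OrderHom.ext _ _ (funext fun q => ?_)))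
    exact (free_hom_apply_mk h.hom (rep q)).symm.trans
      (congrArg (fun q : FreePoset E X => h.hom.toOrderHom q) (mk_rep q))
  right_inv f := PartOrd.ext fun x => freeExt_freeVar B f.hom x

theorem isRightAdjoint_coherentForget (E : Set (Inequation S)) :
    (coherentForget E).IsRightAdjoint :=
  ⟨_, ⟨Adjunction.adjunctionOfEquivLeft (G := coherentForget E) (fun X B => freeHomEquiv E X B)
    fun _ _ _ _ _ => rfl⟩⟩

end FreeAlgebra

/-! ### Enrichment of the free-algebra monad -/

/-- The subalgebra on which the homomorphism `h` is below the homomorphism `k`. -/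
def inserter {A B : Alg S} (hB : B.Coherent) (h k : Alg.Hom A B) : Alg S where
  carrier := PartOrd.of {a : A.carrier // h.toOrderHom a ≤ k.toOrderHom a}
  op σ v := ⟨A.op σ ((OrderHom.Subtype.val _).comp v), by
    rw [h.map_op, k.map_op]
    exact hB _ σ fun i => (v i).2⟩

/-- The inclusion of the subalgebra `inserter hB h k`. -/
def inserterHom {A B : Alg S} (hB : B.Coherent) (h k : Alg.Hom A B) :
    Alg.Hom (inserter hB h k) A where
  toOrderHom := OrderHom.Subtype.val _
  map_op _ _ _ := rfl

/-- The left adjoint of the forgetful functor of a variety of coherent algebras is locally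
monotone. -/
theorem enriched_toMonad {E : Set (Inequation S)}
    {F : PartOrd.{u} ⥤ (coherentVariety E).FullSubcategory} (adj : F ⊣ coherentForget E) :
    Enriched adj.toMonad := by
  intro X Y f g hfg a
  let h : Alg.Hom (F.obj X).obj (F.obj Y).obj := (F.map f).hom
  let k : Alg.Hom (F.obj X).obj (F.obj Y).obj := (F.map g).hom
  let hY := (F.obj Y).property.1
  let I : (coherentVariety E).FullSubcategory := ⟨inserter hY h k,
    Alg.coherentVariety_of_embedding (inserterHom hY h k) (fun _ _ h => h) (F.obj X).property⟩
  let i : I ⟶ F.obj X := ObjectProperty.homMk (inserterHom hY h k)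
  have unit_le (x : X) : h.toOrderHom (adj.unit.app X x) ≤ k.toOrderHom (adj.unit.app X x) := by
    have hf : (coherentForget E).map (F.map f) (adj.unit.app X x) = adj.unit.app Y (f x) :=
      (ConcreteCategory.congr_hom (adj.unit.naturality f) x).symm
    have hg : (coherentForget E).map (F.map g) (adj.unit.app X x) = adj.unit.app Y (g x) :=
      (ConcreteCategory.congr_hom (adj.unit.naturality g) x).symm
    exact hf.le.trans (((adj.unit.app Y).hom.monotone (hfg x)).trans hg.ge)
  let u : X ⟶ (coherentForget E).obj I :=
    PartOrd.ofHom ⟨fun x => ⟨adj.unit.app X x, unit_le x⟩,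
      fun _ _ hxy => (adj.unit.app X).hom.monotone hxy⟩
  let r : F.obj X ⟶ I := (adj.homEquiv X I).symm u
  -- Both sides restrict to the unit along the generators. Hence every `a` is in the image of `i`,
  -- where `h` is below `k`.
  have hr : r ≫ i = 𝟙 (F.obj X) := by
    apply (adj.homEquiv X _).injective
    rw [adj.homEquiv_naturality_right, Equiv.apply_symm_apply, adj.homEquiv_id]
    rfl
  have ha : i.hom.toOrderHom (r.hom.toOrderHom a) = a :=
    ConcreteCategory.congr_hom (congrArg (coherentForget E).map hr) a
  have hle : h.toOrderHom (i.hom.toOrderHom (r.hom.toOrderHom a)) ≤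
      k.toOrderHom (i.hom.toOrderHom (r.hom.toOrderHom a)) := (r.hom.toOrderHom a).2
  rw [ha] at hle
  exact hle

/-! ### Coherence of algebras for an enriched monad -/

section Associated

variable {T : Monad PartOrd.{u}} {A : Alg (assocSignature R T)}

theorem Alg.Evaluates.ofSymbol {B : Alg S} {Γ : R.Idx} (σ : S Γ) (f : R.poset Γ →o B.carrier) :
    B.Evaluates f (.ofSymbol σ) (B.op σ f) :=
  .app σ _ f .var

theorem Alg.Evaluates.ofSymbol_iff {B : Alg S} {Γ : R.Idx} {σ : S Γ} {f : R.poset Γ →o B.carrier}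
    {b : B.carrier} : B.Evaluates f (.ofSymbol σ) b ↔ b = B.op σ f :=
  ⟨fun h => h.unique (.ofSymbol σ f), fun h => h ▸ .ofSymbol σ f⟩

theorem op_symb_mono (hA : variety (assocInequations R T) A) {Γ : R.Idx}
    (f : R.poset Γ →o A.carrier) {σ τ : T.obj (R.poset Γ)} (h : σ ≤ τ) :
    A.op (symb σ) f ≤ A.op (symb τ) f := by
  obtain ⟨a, b, ha, hb, hab⟩ := (A.satisfies_iff _).1 (hA _ (.le Γ σ τ h)) f
  rwa [Alg.Evaluates.ofSymbol_iff.1 ha, Alg.Evaluates.ofSymbol_iff.1 hb] at hab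

theorem op_symb_unit (hA : variety (assocInequations R T) A) {Γ : R.Idx}
    (f : R.poset Γ →o A.carrier) (x : R.poset Γ) :
    A.op (symb (T.η.app (R.poset Γ) x)) f = f x := by
  obtain ⟨a, b, ha, hb, hab⟩ := (A.satisfies_iff _).1 (hA _ (.unit_le Γ x)) f
  obtain ⟨c, d, hc, hd, hcd⟩ := (A.satisfies_iff _).1 (hA _ (.le_unit Γ x)) f
  rw [Alg.Evaluates.ofSymbol_iff.1 ha, Alg.Evaluates.var_iff.1 hb] at hab
  rw [Alg.Evaluates.ofSymbol_iff.1 hd, Alg.Evaluates.var_iff.1 hc] at hcd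
  exact le_antisymm hab hcd

theorem op_symb_kleisliExt (hA : variety (assocInequations R T) A) {Γ Δ : R.Idx}
    (f : R.poset Γ →o A.carrier) (k : R.poset Δ ⟶ T.obj (R.poset Γ)) (σ : T.obj (R.poset Δ))
    (v : R.poset Δ →o A.carrier) (hv : ∀ i, v i = A.op (symb (k i)) f) :
    A.op (symb (kleisliExt T k σ)) f = A.op (symb σ) v := by
  have h : A.Evaluates f (.app (symb σ) fun i => .ofSymbol (symb (k i))) (A.op (symb σ) v) :=
    .app _ _ v fun i => Alg.Evaluates.ofSymbol_iff.2 (hv i)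
  obtain ⟨a, b, ha, hb, hab⟩ := (A.satisfies_iff _).1 (hA _ (.ext_le Γ Δ k σ)) f
  obtain ⟨c, d, hc, hd, hcd⟩ := (A.satisfies_iff _).1 (hA _ (.le_ext Γ Δ k σ)) f
  rw [Alg.Evaluates.ofSymbol_iff.1 ha, hb.unique h] at hab
  rw [Alg.Evaluates.ofSymbol_iff.1 hd, hc.unique h] at hcd
  exact le_antisymm hab hcd

/-- By a unit law of the monad, `T.map j` is the Kleisli extension of `j ≫ η`, so the equations for
Kleisli extensions and for the unit combine. -/
theorem op_symb_map (hA : variety (assocInequations R T) A) {Γ Δ : R.Idx}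
    (f : R.poset Δ →o A.carrier) (j : R.poset Γ ⟶ R.poset Δ) (σ : T.obj (R.poset Γ)) :
    A.op (symb (T.map j σ)) f = A.op (symb σ) (f.comp j.hom) := by
  rw [← op_symb_kleisliExt hA f (j ≫ T.η.app _) σ (f.comp j.hom) fun i =>
    (op_symb_unit hA f (j i)).symm]
  simp [kleisliExt]

/-- All algebras of the variety associated with an enriched monad are coherent. -/
theorem coherent_of_enriched (hT : Enriched T) (hA : variety (assocInequations R T) A) :
    A.Coherent := by
  intro Γ σ v w hvw
  have := R.finite Γ
  -- Two copies of `Γ`, the `false` one below the `true` one: `p` is `v` on the former and `w` on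
  -- the latter, and `v ≤ w` gives monotonicity between the copies.
  obtain ⟨Δ, ⟨e⟩⟩ := R.exists_iso (R.poset Γ × ULift.{u} Bool)
  let p : R.poset Γ × ULift.{u} Bool →o A.carrier :=
    ⟨fun x => cond x.2.down (w x.1) (v x.1), by
      rintro ⟨x, ⟨_ | _⟩⟩ ⟨y, ⟨_ | _⟩⟩ ⟨hxy, hb⟩
      · exact v.monotone hxy
      · exact (v.monotone hxy).trans (hvw y)
      · exact absurd (show true ≤ false from hb) (by decide)
      · exact w.monotone hxy⟩
  let f : R.poset Δ →o A.carrier := p.comp e.symm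
  let inj (b : Bool) : R.poset Γ ⟶ R.poset Δ :=
    PartOrd.ofHom ⟨fun x => e (x, ⟨b⟩), fun x y h => e.monotone ⟨h, le_rfl⟩⟩
  -- Enrichment enters here, since `inj false ≤ inj true` pointwise.
  have hle : T.map (inj false) σ ≤ T.map (inj true) σ :=
    hT _ _ (fun x =>
      e.monotone (a := (x, ⟨false⟩)) (b := (x, ⟨true⟩)) ⟨le_rfl, Bool.false_le true⟩) σ
  have h0 : f.comp (inj false).hom = v := OrderHom.ext _ _ (funext fun x =>
    congrArg p (e.symm_apply_apply (x, ⟨false⟩)))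
  have h1 : f.comp (inj true).hom = w := OrderHom.ext _ _ (funext fun x =>
    congrArg p (e.symm_apply_apply (x, ⟨true⟩)))
  calc A.op σ v = A.op (symb (T.map (inj false) σ)) f :=
        ((op_symb_map hA f _ _).trans (congrArg (A.op σ) h0)).symm
    _ ≤ A.op (symb (T.map (inj true) σ)) f := op_symb_mono hA f hle
    _ = A.op σ w := (op_symb_map hA f _ _).trans (congrArg (A.op σ) h1)

end Associated

end OrderedAlgebra

/-- First part: for every enriched finitary monad `T`, all algebras of its associated variety are
coherent. Second part: every variety of coherent algebras has free algebras, and its free-algebra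
monad (the monad of any adjunction `F ⊣ U` with `U` the forgetful functor) is enriched. -/
theorem propositionP (R : OrderedAlgebra.Contexts.{u}) :
    (∀ T : Monad PartOrd.{u}, Limits.PreservesFilteredColimits T.toFunctor →
      OrderedAlgebra.Enriched T →
      ∀ A : OrderedAlgebra.Alg (OrderedAlgebra.assocSignature R T),
        OrderedAlgebra.variety (OrderedAlgebra.assocInequations R T) A → A.Coherent) ∧
    (∀ (S : OrderedAlgebra.Signature R) (E : Set (OrderedAlgebra.Inequation S)),
      (OrderedAlgebra.coherentForget E).IsRightAdjoint ∧
      ∀ (F : PartOrd.{u} ⥤ (OrderedAlgebra.coherentVariety E).FullSubcategory)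
        (adj : F ⊣ OrderedAlgebra.coherentForget E),
        OrderedAlgebra.Enriched adj.toMonad) := by
  exact ⟨fun T _ hT A hA => OrderedAlgebra.coherent_of_enriched hT hA, fun S E =>
    ⟨OrderedAlgebra.isRightAdjoint_coherentForget E, fun _ adj =>
      OrderedAlgebra.enriched_toMonad adj⟩⟩
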